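/- **Setting.** An instance $I$ consists of a finite set $N$ of agents, a finite set $\mathcal V$ of plots with $|\mathcal V|=|N|$, an undirected plot graph $(\mathcal V,\mathcal E)$, valuations $u_i:\mathcal V\to[0,1]\cap\mathbb Q$ for $i\in N$, a symmetric irreflexive friendship relation $F\subseteq N\times N$, and weights $\phi_{i,j}\in\mathbb Q_{\ge 0}$ for $(i,j)\in F$. An allocation is a bijection $A:N\to\mathcal V$; the utility of agent $i$ is $$U_i(A)=u_i(A(i))+\sum_{j:(i,j)\in F}\phi_{i,j}\,\mathbb I\bigl(\{A(i),A(j)\}\in\mathcal E\bigr),$$ $\mathrm{SW}(A)=\sum_{i\in N}U_i(A)$, and $\mathrm{OPT}(I)=\max_A\mathrm{SW}(A)$. Put $\phi_{\min}=\min_{(i,j)\in F}\phi_{i,j}$ ($+\infty$ if $F=\varnothing$). The instance is binary if $u_i(v)\in\{0,1\}$ for all $i\in N$ and $v\in\mathcal V$, and friendship-uniform if there is $\phi>0$ with $\phi_{i,j}=\phi$ for all $(i,j)\in F$. **Mechanism FF-CT-RSD\*.** Each agent reports at most one friend; let $P$ be the set of pairs $\{i,j\}$ who report each other. As long as $P\ne\varnothing$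 and two adjacent plots are both unoccupied, a uniformly random pair is removed from $P$, and its two members, in uniformly random order, pick one unoccupied plot each. Once $P=\varnothing$ or no two unoccupied plots are adjacent, RSD\* is run on the remaining agents and plots: as long as some remaining agent has a positive value for some unoccupied plot, a uniformly random such agent picks an unoccupied plot; when there is no such agent, the remaining agents are paired arbitrarily with the remaining plots. Agents pick optimally: the second member of a pair maximizes her utility given the plot of the first; the first maximizes her (expected) utility anticipating the reaction of the second; an agent who picks alone takes an unoccupied plot of maximum value to her. Ties are broken arbitrarily, possibly at random and depending on the history. **Theorem.** Let $I$ be a binary, friendship-uniform instance in which every agent has at most one friend and $\phi_{\min}>1$, and suppose that the agents report their friendships truthfully. Let $A$ be the random allocation output by FF-CT-RSD\*. Then, however ties are broken and however the remaining agents are paired with the remaining plots at the end, $$\mathbb E\bigl(\mathrm{SW}(A)\bigr)\ \ge\ \tfrac14\,\mathrm{OPT}(I).$$ -/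

import Mathlib

/-- An instance of the plot allocation problem: as many plots `V` as agents `N`, an undirected plot
graph, plot values `u i v ∈ [0,1] ∩ ℚ`, reciprocal friendships, and friendship weights
`φ i j ∈ ℚ≥0` (only the values at pairs of friends matter; `φ i j ≠ φ j i` is allowed). -/
structure PlotInstance (N V : Type*) [Fintype N] [Fintype V] where
  card_eq : Fintype.card N = Fintype.card V
  plot : SimpleGraph V
  friend : SimpleGraph N
  u : N → V → ℚ
  u_nonneg : ∀ i v, 0 ≤ u i v
  u_le_one : ∀ i v, u i v ≤ 1
  φ : N → N → ℚ
  φ_nonneg : ∀ i j, 0 ≤ φ i j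

namespace PlotInstance

noncomputable section

variable {N V : Type*} [Fintype N] [Fintype V] (I : PlotInstance N V)

/-- The smallest friendship weight (`⊤` if there are no friends). -/
def phiMin : WithTop ℚ :=
  open scoped Classical in
  (Finset.univ.filter fun p : N × N => I.friend.Adj p.1 p.2).inf
    fun p => ((I.φ p.1 p.2 : ℚ) : WithTop ℚ)

def Binary : Prop := ∀ i v, I.u i v = 0 ∨ I.u i v = 1

def FriendshipUniform : Prop := ∃ c : ℚ, 0 < c ∧ ∀ i j, I.friend.Adj i j → I.φ i j = c

/-- The friendship graph has maximum degree at most one. -/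
def AtMostOneFriend : Prop := ∀ i j k, I.friend.Adj i j → I.friend.Adj i k → j = k

/-- The utility of agent `i` under the allocation `A`. -/
def utility (A : N ≃ V) (i : N) : ℚ :=
  open scoped Classical in
  I.u i (A i) + ∑ j ∈ Finset.univ.filter (fun j => I.friend.Adj i j),
    I.φ i j * (if I.plot.Adj (A i) (A j) then 1 else 0)

def socialWelfare (A : N ≃ V) : ℚ := ∑ i, I.utility A i

/-- The maximum social welfare of an allocation. -/
def opt : ℚ :=
  open scoped Classical in
  (Finset.univ : Finset (N ≃ V)).sup' ⟨Fintype.equivOfCardEq I.card_eq, Finset.mem_univ _⟩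
    I.socialWelfare

/-- Expected social welfare of a random allocation. -/
def expectedWelfare (p : PMF (N ≃ V)) : ℝ :=
  open scoped Classical in
  ∑ A : N ≃ V, (p A).toReal * (I.socialWelfare A : ℝ)

/-- `report i` is the agent whom `i` names as her friend (`none` for no friend). -/
def TruthfulReport (report : N → Option N) : Prop :=
  ∀ i j, report i = some j ↔ I.friend.Adj i j

end

end PlotInstance

namespace FFCT

noncomputable section

variable {N V : Type*} [Fintype N] [Fintype V]

/-- Plots still available after the picks recorded in the history `h`
(a list of pairs `(agent, plot she took)`, the latest pick first). -/
def availablePlots (h : List (N × V)) : Finset V :=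
  open scoped Classical in
  Finset.univ.filter fun v => v ∉ h.map Prod.snd

/-- Agents who have not picked yet. -/
def remainingAgents (h : List (N × V)) : Finset N :=
  open scoped Classical in
  Finset.univ.filter fun i => i ∉ h.map Prod.fst

/-- The pairs of agents who name each other as friends and have not picked yet. Each unordered pair
occurs in both orders `(i, j)` and `(j, i)`, so that a uniformly random element of this set is a
uniformly random unordered pair together with a uniformly random order within the pair. -/
def orderedPairs (report : N → Option N) (h : List (N × V)) : Finset (N × N) :=
  open scoped Classical in
  Finset.univ.filter fun p => p.1 ≠ p.2 ∧ report p.1 = some p.2 ∧ report p.2 = some p.1 ∧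
    p.1 ∈ remainingAgents h ∧ p.2 ∈ remainingAgents h

variable (I : PlotInstance N V)

/-- Some two available plots are adjacent. -/
def AdjacentAvailable (h : List (N × V)) : Prop :=
  ∃ v ∈ availablePlots h, ∃ w ∈ availablePlots h, I.plot.Adj v w

/-- The condition under which another pair of friends is called. -/
def PairPhase (report : N → Option N) (h : List (N × V)) : Prop :=
  (orderedPairs report h).Nonempty ∧ AdjacentAvailable I h

/-- Utility of `i` when she gets `v` and the other member `j` of her pair gets `w`. -/
def pairUtility (i j : N) (v w : V) : ℚ :=
  open scoped Classical in
  I.u i v + (if I.friend.Adj i j ∧ I.plot.Adj v w then I.φ i j else 0)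

/-- `response v` is how `j`, who moves right after `i`, picks when `i` has picked `v`: for every
available `v` she picks, among the plots then available, one that maximizes her utility. Ties may be
broken in any way, also at random. -/
def OptimalSecond (h : List (N × V)) (i j : N) (response : V → PMF V) : Prop :=
  ∀ v ∈ availablePlots h, ∀ w ∈ (response v).support,
    w ∈ availablePlots h ∧ w ≠ v ∧
    ∀ w' ∈ availablePlots h, w' ≠ v → pairUtility I j i w' v ≤ pairUtility I j i w v

/-- The expected utility of `i` when she picks `v` and `j` then picks according to `response v`. -/
def anticipatedUtility (i j : N) (response : V → PMF V) (v : V) : ℝ :=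
  ∑ w, (response v w).toReal * (pairUtility I i j v w : ℝ)

/-- `first` is how `i`, who anticipates the reaction `response` of `j`, picks: an available plot that
maximizes her expected utility, with ties broken in any way. -/
def OptimalFirst (h : List (N × V)) (i j : N) (response : V → PMF V) (first : PMF V) : Prop :=
  ∀ v ∈ first.support, v ∈ availablePlots h ∧
    ∀ v' ∈ availablePlots h,
      anticipatedUtility I i j response v' ≤ anticipatedUtility I i j response v

/-- The remaining agents who have a positive value for some available plot. -/
def yesAgents (h : List (N × V)) : Finset N :=
  open scoped Classical in
  (remainingAgents h).filter fun i => ∃ v ∈ availablePlots h, 0 < I.u i v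

/-- An agent who picks alone picks an available plot of maximum value, with ties broken in any way. -/
def OptimalSingle (h : List (N × V)) (i : N) (choice : PMF V) : Prop :=
  ∀ v ∈ choice.support, v ∈ availablePlots h ∧ ∀ v' ∈ availablePlots h, I.u i v' ≤ I.u i v

/-- `IsOutcome I report h p`: from the history `h` on, `p` is a possible distribution of the final
allocation of the mechanism FF-CT-RSD* under the friendship reports `report`, when the agents pick
optimally. All choices that the mechanism and optimality leave open (tie breaking, and the pairing of
the agents and plots that are left at the end) are arbitrary and may depend on the history. -/
inductive IsOutcome (report : N → Option N) : List (N × V) → PMF (N ≃ V) → Prop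
  /-- While there are an unserved pair and two adjacent available plots: a uniformly random pair,
  in uniformly random order, picks two plots. -/
  | pair (h : List (N × V)) (hphase : PairPhase I report h)
      (first : N × N → PMF V) (second : N × N → V → PMF V)
      (next : N × N → V → V → PMF (N ≃ V))
      (hsecond : ∀ q ∈ orderedPairs report h, OptimalSecond I h q.1 q.2 (second q))
      (hfirst : ∀ q ∈ orderedPairs report h, OptimalFirst I h q.1 q.2 (second q) (first q))
      (hnext : ∀ q ∈ orderedPairs report h, ∀ v ∈ (first q).support, ∀ w ∈ (second q v).support,
        IsOutcome report ((q.2, w) :: (q.1, v) :: h) (next q v w)) :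
      IsOutcome report h
        ((PMF.uniformOfFinset (orderedPairs report h) hphase.1).bind fun q =>
          (first q).bind fun v => (second q v).bind fun w => next q v w)
  /-- Afterwards, while some remaining agent has a positive value for some available plot: a
  uniformly random such agent picks a plot. -/
  | single (h : List (N × V)) (hphase : ¬ PairPhase I report h) (hyes : (yesAgents I h).Nonempty)
      (choice : N → PMF V) (next : N → V → PMF (N ≃ V))
      (hchoice : ∀ i ∈ yesAgents I h, OptimalSingle I h i (choice i))
      (hnext : ∀ i ∈ yesAgents I h, ∀ v ∈ (choice i).support,
        IsOutcome report ((i, v) :: h) (next i v)) :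
      IsOutcome report h
        ((PMF.uniformOfFinset (yesAgents I h) hyes).bind fun i =>
          (choice i).bind fun v => next i v)
  /-- Finally the remaining agents and plots are paired arbitrarily. -/
  | finish (h : List (N × V)) (hphase : ¬ PairPhase I report h) (hno : ¬ (yesAgents I h).Nonempty)
      (p : PMF (N ≃ V)) (hp : ∀ A ∈ p.support, ∀ q ∈ h, A q.1 = q.2) :
      IsOutcome report h p

end

end FFCT

/-!
The bound holds for every allocation `A` in the support of the outcome, so no averaging over the
random choices is needed.

Write `c > 1` for the common friendship weight, let `B` be any allocation with total plot value `M`,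
and let `k` be the number of pairs of friends called on the way to `A`.

* Since `c > 1` exceeds every plot value, both members of a called pair prefer adjacency to any plot
  value (`FFCT.OptimalSecond.adj`, `FFCT.OptimalFirst.exists_adj`), so each call contributes `2 * c`
  to the welfare of `A`.
* The pair phase ends either because all pairs have been called, or because the `2 * k` plots taken
  cover all edges of the plot graph. In both cases at most `2 * k` pairs of friends are adjacent
  under `B` (`FFCT.Bottleneck.card_adjacentFriends_le`).
* One pick destroys at most two units of plot value of `B`: the value of the picking agent and
  the value of the agent to whom `B` gives the picked plot (`FFCT.residualValue_le_cons`). So at least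
  `M - 4 * k` is left when the pair phase ends, and the single phase, a greedy matching in
  which every pick has value one, collects at least half of what is left.

Hence `4 * SW(A) ≥ 8 * c * k + max 0 (2 * (M - 4 * k)) ≥ 8 * c * k + M - 4 * k ≥ M + 4 * c * k`, while
`SW(B) ≤ M + 4 * c * k`. The accounting along the run of the mechanism is
`FFCT.IsOutcome.exists_calls`.
-/

/-! ### Optimal play within a pair of friends -/

namespace FFCT

variable {N V : Type*} [Fintype N] [Fintype V]

theorem sum_toReal_eq_one {α : Type*} [Fintype α] (p : PMF α) : ∑ a, (p a).toReal = 1 := by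
  rw [← ENNReal.toReal_sum fun a _ => p.apply_ne_top a, ← tsum_fintype (L := .unconditional α),
    p.tsum_coe, ENNReal.toReal_one]

/-- An average is at least any lower bound that holds on the support. -/
theorem le_sum_toReal_mul {α : Type*} [Fintype α] (p : PMF α) (f : α → ℝ) (b : ℝ)
    (hf : ∀ a ∈ p.support, b ≤ f a) : b ≤ ∑ a, (p a).toReal * f a := by
  calc b = ∑ a, (p a).toReal * b := by rw [← Finset.sum_mul, sum_toReal_eq_one, one_mul]
    _ ≤ _ := Finset.sum_le_sum fun a _ => by
      by_cases ha : a ∈ p.support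
      · exact mul_le_mul_of_nonneg_left (hf a ha) ENNReal.toReal_nonneg
      · rw [PMF.mem_support_iff, not_not] at ha
        simp [ha]

theorem sum_toReal_mul_le {α : Type*} [Fintype α] (p : PMF α) (f : α → ℝ) (b : ℝ)
    (hf : ∀ a ∈ p.support, f a ≤ b) : ∑ a, (p a).toReal * f a ≤ b := by
  have h := le_sum_toReal_mul p (fun a => -f a) (-b) fun a ha => neg_le_neg (hf a ha)
  simp only [mul_neg, Finset.sum_neg_distrib] at h
  exact neg_le_neg_iff.mp h

variable {I : PlotInstance N V} {h : List (N × V)}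

theorem OptimalSecond.adj {i j : N} {response : V → PMF V} (hs : OptimalSecond I h i j response)
    (hij : I.friend.Adj i j) (hφ : 1 < I.φ j i) {v w' : V} (hv : v ∈ availablePlots h)
    (hw' : w' ∈ availablePlots h) (hvw' : I.plot.Adj v w') {w : V}
    (hw : w ∈ (response v).support) : I.plot.Adj v w := by
  obtain ⟨-, -, hmax⟩ := hs v hv w hw
  by_contra hvw
  have hle := hmax w' hw' hvw'.ne'
  have hwv : ¬ I.plot.Adj w v := fun h => hvw h.symm
  simp only [pairUtility, hij.symm, hvw'.symm, hwv, and_self, and_false, if_true, if_false] at hle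
  linarith [I.u_nonneg j w', I.u_le_one j w]

theorem OptimalFirst.exists_adj {i j : N} {response : V → PMF V} {first : PMF V}
    (hf : OptimalFirst I h i j response first) (hs : OptimalSecond I h i j response)
    (hij : I.friend.Adj i j) (hφi : 1 < I.φ i j) (hφj : 1 < I.φ j i) (hadj : AdjacentAvailable I h)
    {v : V} (hv : v ∈ first.support) : ∃ w ∈ availablePlots h, I.plot.Adj v w := by
  obtain ⟨hva, hmax⟩ := hf v hv
  by_contra! hnone
  obtain ⟨x, hx, y, hy, hxy⟩ := hadj
  have hlow : ((I.φ i j : ℚ) : ℝ) ≤ anticipatedUtility I i j response x := by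
    refine le_sum_toReal_mul _ _ _ fun w hw => ?_
    have hxw := hs.adj hij hφj hx hy hxy hw
    simp only [pairUtility, hij, hxw, and_self, if_true]
    exact_mod_cast le_add_of_nonneg_left (I.u_nonneg i x)
  have hhigh : anticipatedUtility I i j response v ≤ 1 := by
    refine sum_toReal_mul_le _ _ _ fun w hw => ?_
    have hvw := hnone w (hs v hva w hw).1
    simp only [pairUtility, hvw, and_false, if_false, add_zero]
    exact_mod_cast I.u_le_one i v
  have hφ : (1 : ℝ) < ((I.φ i j : ℚ) : ℝ) := by exact_mod_cast hφi
  linarith [hmax x hx]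

/-! ### Histories -/

omit [Fintype N] in
@[simp] theorem mem_availablePlots {v : V} : v ∈ availablePlots h ↔ v ∉ h.map Prod.snd := by
  simp only [availablePlots, Finset.mem_filter, Finset.mem_univ, true_and]

omit [Fintype V] in
@[simp] theorem mem_remainingAgents {i : N} : i ∈ remainingAgents h ↔ i ∉ h.map Prod.fst := by
  simp only [remainingAgents, Finset.mem_filter, Finset.mem_univ, true_and]

omit [Fintype N] in
theorem mem_availablePlots_cons {q : N × V} {v : V} :
    v ∈ availablePlots (q :: h) ↔ v ≠ q.2 ∧ v ∈ availablePlots h := by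
  simp only [mem_availablePlots, List.map_cons, List.mem_cons, not_or, ne_eq]

omit [Fintype V] in
theorem mem_remainingAgents_cons {q : N × V} {i : N} :
    i ∈ remainingAgents (q :: h) ↔ i ≠ q.1 ∧ i ∈ remainingAgents h := by
  simp only [mem_remainingAgents, List.map_cons, List.mem_cons, not_or, ne_eq]

omit [Fintype V] in
open scoped Classical in
theorem remainingAgents_cons (q : N × V) :
    remainingAgents (q :: h) = (remainingAgents h).erase q.1 := by
  ext i
  rw [mem_remainingAgents_cons, Finset.mem_erase]

omit [Fintype V] in
theorem mem_orderedPairs {report : N → Option N} {q : N × N} :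
    q ∈ orderedPairs report h ↔ q.1 ≠ q.2 ∧ report q.1 = some q.2 ∧ report q.2 = some q.1 ∧
      q.1 ∈ remainingAgents h ∧ q.2 ∈ remainingAgents h := by
  simp only [orderedPairs, Finset.mem_filter, Finset.mem_univ, true_and]

/-! ### Values and adjacent friends of agents who have not picked -/

/-- The plot value that `A` gives to the agents who have not picked yet. -/
noncomputable def futureValue (I : PlotInstance N V) (A : N ≃ V) (h : List (N × V)) : ℚ :=
  ∑ i ∈ remainingAgents h, I.u i (A i)

open scoped Classical in
/-- The plot value that `B` gives to the agents who have not picked yet and whose plot in `B`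
is still available. -/
noncomputable def residualValue (I : PlotInstance N V) (B : N ≃ V) (h : List (N × V)) : ℚ :=
  ∑ i ∈ (remainingAgents h).filter fun i => B i ∈ availablePlots h, I.u i (B i)

open scoped Classical in
/-- The pairs of friends who have not picked yet and get adjacent plots in `A`. As in
`orderedPairs`, each unordered pair occurs in both orders. -/
noncomputable def adjacentFriends (I : PlotInstance N V) (A : N ≃ V) (h : List (N × V)) :
    Finset (N × N) :=
  Finset.univ.filter fun q => I.friend.Adj q.1 q.2 ∧ I.plot.Adj (A q.1) (A q.2) ∧
    q.1 ∈ remainingAgents h ∧ q.2 ∈ remainingAgents h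

theorem mem_adjacentFriends {A : N ≃ V} {q : N × N} :
    q ∈ adjacentFriends I A h ↔ I.friend.Adj q.1 q.2 ∧ I.plot.Adj (A q.1) (A q.2) ∧
      q.1 ∈ remainingAgents h ∧ q.2 ∈ remainingAgents h := by
  simp only [adjacentFriends, Finset.mem_filter, Finset.mem_univ, true_and]

theorem futureValue_nonneg (A : N ≃ V) : 0 ≤ futureValue I A h :=
  Finset.sum_nonneg fun i _ => I.u_nonneg i (A i)

theorem futureValue_cons (A : N ≃ V) {q : N × V} (hq : q.1 ∈ remainingAgents h) :
    futureValue I A h = I.u q.1 (A q.1) + futureValue I A (q :: h) := by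
  classical
  rw [futureValue, futureValue, remainingAgents_cons, Finset.add_sum_erase _ (fun i => I.u i (A i)) hq]

/-- A pick costs `B` at most the value of the picking agent and that of the agent to whom `B` gives
the picked plot. -/
theorem residualValue_le_cons (B : N ≃ V) (q : N × V) :
    residualValue I B h ≤ residualValue I B (q :: h) + 2 := by
  classical
  set S := (remainingAgents h).filter fun i => B i ∈ availablePlots h with hS
  set T := (remainingAgents (q :: h)).filter fun i => B i ∈ availablePlots (q :: h) with hT
  have hsub : S ⊆ T ∪ {q.1, B.symm q.2} := by
    intro i hi
    simp only [hS, hT, Finset.mem_filter, Finset.mem_union, Finset.mem_insert,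
      Finset.mem_singleton, mem_remainingAgents_cons, mem_availablePlots_cons,
      Equiv.eq_symm_apply] at hi ⊢
    tauto
  have hnn : ∀ i, 0 ≤ I.u i (B i) := fun i => I.u_nonneg i (B i)
  calc ∑ i ∈ S, I.u i (B i) ≤ ∑ i ∈ T ∪ {q.1, B.symm q.2}, I.u i (B i) :=
        Finset.sum_le_sum_of_subset_of_nonneg hsub fun i _ _ => hnn i
    _ ≤ ∑ i ∈ T, I.u i (B i) + ∑ i ∈ {q.1, B.symm q.2}, I.u i (B i) := by
        rw [← Finset.sum_union_inter]
        exact le_add_of_nonneg_right (Finset.sum_nonneg fun i _ => hnn i)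
    _ ≤ ∑ i ∈ T, I.u i (B i) + 2 := by
        gcongr
        calc ∑ i ∈ {q.1, B.symm q.2}, I.u i (B i)
            ≤ (({q.1, B.symm q.2} : Finset N).card : ℚ) := by
              simpa using Finset.sum_le_card_nsmul {q.1, B.symm q.2} (fun i => I.u i (B i)) 1
                fun i _ => I.u_le_one i (B i)
          _ ≤ 2 := by exact_mod_cast Finset.card_le_two

theorem residualValue_nonpos_of_yesAgents_empty (B : N ≃ V) (hno : ¬ (yesAgents I h).Nonempty) :
    residualValue I B h ≤ 0 := by
  classical
  refine Finset.sum_nonpos fun i hi => ?_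
  rw [Finset.mem_filter] at hi
  by_contra! hpos
  refine hno ⟨i, ?_⟩
  simp only [yesAgents, Finset.mem_filter]
  exact ⟨hi.1, B i, hi.2, hpos⟩

theorem adjacentFriends_cons_subset (A : N ≃ V) (q : N × V) :
    adjacentFriends I A (q :: h) ⊆ adjacentFriends I A h := by
  intro r hr
  simp only [mem_adjacentFriends, mem_remainingAgents_cons] at hr ⊢
  exact ⟨hr.1, hr.2.1, hr.2.2.1.2, hr.2.2.2.2⟩

/-- A called pair that gets adjacent plots accounts for two ordered pairs of adjacent friends. -/
theorem card_adjacentFriends_cons_cons (A : N ≃ V) {i j : N} {v w : V} (hij : I.friend.Adj i j)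
    (hA : I.plot.Adj (A i) (A j)) (hi : i ∈ remainingAgents h) (hj : j ∈ remainingAgents h) :
    (adjacentFriends I A ((j, w) :: (i, v) :: h)).card + 2 ≤ (adjacentFriends I A h).card := by
  classical
  have hne : ((i, j) : N × N) ≠ (j, i) := fun he => hij.ne (congrArg Prod.fst he)
  rw [← Finset.card_pair hne, ← Finset.card_union_of_disjoint]
  · refine Finset.card_le_card (Finset.union_subset ?_ ?_)
    · exact (adjacentFriends_cons_subset A _).trans (adjacentFriends_cons_subset A _)
    · intro r hr
      rw [Finset.mem_insert, Finset.mem_singleton] at hr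
      rcases hr with rfl | rfl
      · exact mem_adjacentFriends.mpr ⟨hij, hA, hi, hj⟩
      · exact mem_adjacentFriends.mpr ⟨hij.symm, hA.symm, hj, hi⟩
  · rw [Finset.disjoint_right]
    intro r hr hr'
    rw [Finset.mem_insert, Finset.mem_singleton] at hr
    simp only [mem_adjacentFriends, mem_remainingAgents_cons] at hr'
    rcases hr with rfl | rfl <;> simp at hr'

/-! ### What bounds the number of calls -/

/-- From the history `h` on, `k` calls are enough to call every pair, or for the plots taken by the
called pairs to cover all edges between available plots. This survives adding a call in front, unlike
a direct bound on the number of friends adjacent under another allocation. -/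
def Bottleneck (I : PlotInstance N V) (report : N → Option N) (h : List (N × V)) (k : ℕ) : Prop :=
  (orderedPairs report h).card ≤ 2 * k ∨
    ∃ S : Finset V, S.card ≤ 2 * k ∧ ∀ v ∈ availablePlots h, ∀ w ∈ availablePlots h,
      I.plot.Adj v w → v ∈ S ∨ w ∈ S

variable {report : N → Option N}

theorem bottleneck_of_not_pairPhase (hphase : ¬ PairPhase I report h) (k : ℕ) :
    Bottleneck I report h k := by
  by_cases hP : (orderedPairs report h).Nonempty
  · refine Or.inr ⟨∅, by simp, fun v hv w hw hvw => ?_⟩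
    exact absurd ⟨hP, v, hv, w, hw, hvw⟩ hphase
  · rw [Finset.not_nonempty_iff_eq_empty] at hP
    exact Or.inl (by simp [hP])

theorem Bottleneck.of_cons_cons {i j : N} {v w : V} {k : ℕ} (hij : (i, j) ∈ orderedPairs report h)
    (hk : Bottleneck I report ((j, w) :: (i, v) :: h) k) : Bottleneck I report h (k + 1) := by
  classical
  rcases hk with hk | ⟨S, hS, hcov⟩
  · left
    have hsub : orderedPairs report h ⊆
        orderedPairs report ((j, w) :: (i, v) :: h) ∪ {(i, j), (j, i)} := by
      rintro ⟨a, b⟩ hab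
      rw [mem_orderedPairs] at hij hab
      simp only [Finset.mem_union, Finset.mem_insert, Finset.mem_singleton, mem_orderedPairs,
        mem_remainingAgents_cons, Prod.mk.injEq]
      grind
    have hcard := (Finset.card_le_card hsub).trans (Finset.card_union_le _ _)
    have htwo : ({(i, j), (j, i)} : Finset (N × N)).card ≤ 2 := Finset.card_le_two
    omega
  · refine Or.inr ⟨S ∪ {v, w}, ?_, fun x hx y hy hxy => ?_⟩
    · have hcard := Finset.card_union_le S {v, w}
      have htwo : ({v, w} : Finset V).card ≤ 2 := Finset.card_le_two
      omega
    · have hcov' := fun hx' hy' => hcov x hx' y hy' hxy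
      simp only [mem_availablePlots_cons] at hcov'
      simp only [Finset.mem_union, Finset.mem_insert, Finset.mem_singleton]
      tauto

/-- At most `2 * k` unordered pairs of friends are adjacent under any allocation if `k` calls exhaust
the pairs or cover the edges. -/
theorem Bottleneck.card_adjacentFriends_le (hfriend : I.AtMostOneFriend)
    (hreport : I.TruthfulReport report) {k : ℕ} (hk : Bottleneck I report [] k) (B : N ≃ V) :
    (adjacentFriends I B []).card ≤ 4 * k := by
  classical
  rcases hk with hk | ⟨S, hS, hcov⟩
  · have hsub : adjacentFriends I B [] ⊆ orderedPairs report ([] : List (N × V)) := by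
      intro q hq
      rw [mem_adjacentFriends] at hq
      rw [mem_orderedPairs]
      exact ⟨hq.1.ne, (hreport _ _).mpr hq.1, (hreport _ _).mpr hq.1.symm, hq.2.2⟩
    have := Finset.card_le_card hsub
    omega
  · set E := adjacentFriends I B [] with hE
    -- An adjacent pair of friends is determined by either of its members.
    have hfst : (E.filter fun q => B q.1 ∈ S).card ≤ S.card := by
      refine Finset.card_le_card_of_injOn (fun q => B q.1)
        (fun q hq => (Finset.mem_filter.mp hq).2) fun q hq r hr hqr => ?_
      have hq := (mem_adjacentFriends.mp (Finset.mem_filter.mp hq).1).1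
      have hr := (mem_adjacentFriends.mp (Finset.mem_filter.mp hr).1).1
      have h1 : q.1 = r.1 := B.injective hqr
      exact Prod.ext h1 (hfriend _ _ _ hq (h1 ▸ hr))
    have hsnd : (E.filter fun q => B q.2 ∈ S).card ≤ S.card := by
      refine Finset.card_le_card_of_injOn (fun q => B q.2)
        (fun q hq => (Finset.mem_filter.mp hq).2) fun q hq r hr hqr => ?_
      have hq := (mem_adjacentFriends.mp (Finset.mem_filter.mp hq).1).1
      have hr := (mem_adjacentFriends.mp (Finset.mem_filter.mp hr).1).1
      have h2 : q.2 = r.2 := B.injective hqr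
      exact Prod.ext (hfriend _ _ _ hq.symm (h2 ▸ hr.symm)) h2
    have hsub : E ⊆ (E.filter fun q => B q.1 ∈ S) ∪ E.filter fun q => B q.2 ∈ S := by
      intro q hq
      have hadj := (mem_adjacentFriends.mp hq).2.1
      have := hcov _ (by simp) _ (by simp) hadj
      simp only [Finset.mem_union, Finset.mem_filter]
      tauto
    have hcard := (Finset.card_le_card hsub).trans (Finset.card_union_le _ _)
    omega

/-! ### Accounting along a run -/

/-- Every possible final allocation `A` comes with a number `k` of calls of pairs of friends. -/
theorem IsOutcome.exists_calls (hbinary : I.Binary)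
    (hφ : ∀ i j, I.friend.Adj i j → 1 < I.φ i j) (hreport : I.TruthfulReport report) (B : N ≃ V)
    {p : PMF (N ≃ V)} (hp : IsOutcome I report h p) {A : N ≃ V} (hA : A ∈ p.support) :
    (∀ q ∈ h, A q.1 = q.2) ∧ ∃ k : ℕ, residualValue I B h - 4 * k ≤ 2 * futureValue I A h ∧
      2 * k ≤ (adjacentFriends I A h).card ∧ Bottleneck I report h k := by
  induction hp with
  | pair h hphase first second next hsecond hfirst hnext ih =>
    simp only [PMF.mem_support_bind_iff, PMF.mem_support_uniformOfFinset_iff] at hA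
    obtain ⟨⟨i, j⟩, hq, v, hv, w, hw, hA⟩ := hA
    obtain ⟨hagree, k, hval, hedge, hbot⟩ := ih _ hq v hv w hw hA
    obtain ⟨hne, hij, hji, hi, hj⟩ := mem_orderedPairs.mp hq
    have hadj : I.friend.Adj i j := (hreport _ _).mp hij
    obtain ⟨w', hw', hvw'⟩ := (hfirst _ hq).exists_adj (hsecond _ hq) hadj (hφ _ _ hadj)
      (hφ _ _ hadj.symm) hphase.2 hv
    have hvw : I.plot.Adj v w := (hsecond _ hq).adj hadj (hφ _ _ hadj.symm)
      (hfirst _ hq v hv).1 hw' hvw' hw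
    have hAi : A i = v := hagree (i, v) (by simp)
    have hAj : A j = w := hagree (j, w) (by simp)
    refine ⟨fun q hqh => hagree q (by simp [hqh]), k + 1, ?_, ?_, hbot.of_cons_cons hq⟩
    · have hj' : j ∈ remainingAgents ((i, v) :: h) :=
        mem_remainingAgents_cons.mpr ⟨hne.symm, hj⟩
      have h1 := futureValue_cons (I := I) A (q := (i, v)) hi
      have h2 := futureValue_cons (I := I) A (q := (j, w)) hj'
      have h3 := residualValue_le_cons (I := I) (h := h) B (i, v)
      have h4 := residualValue_le_cons (I := I) (h := (i, v) :: h) B (j, w)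
      have h5 := I.u_nonneg i (A i)
      have h6 := I.u_nonneg j (A j)
      dsimp only at h1 h2 hval
      push_cast
      linarith
    · have := card_adjacentFriends_cons_cons (v := v) (w := w) A hadj (by rwa [hAi, hAj]) hi hj
      dsimp only at hedge
      omega
  | single h hphase hyes choice next hchoice hnext ih =>
    simp only [PMF.mem_support_bind_iff, PMF.mem_support_uniformOfFinset_iff] at hA
    obtain ⟨i, hi, v, hv, hA⟩ := hA
    obtain ⟨hagree, k, hval, hedge, -⟩ := ih i hi v hv hA
    have hAi : A i = v := hagree (i, v) (by simp)
    obtain ⟨hrem, v', hv', hpos⟩ : i ∈ remainingAgents h ∧ ∃ v' ∈ availablePlots h, 0 < I.u i v' := by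
      simpa only [yesAgents, Finset.mem_filter] using hi
    -- The agent likes some available plot, so in a binary instance her pick has value one.
    have hone : I.u i (A i) = 1 := by
      have hle := (hchoice i hi v hv).2 v' hv'
      rw [hAi]
      exact (hbinary i v).resolve_left (hpos.trans_le hle).ne'
    refine ⟨fun q hqh => hagree q (by simp [hqh]), k, ?_, ?_, bottleneck_of_not_pairPhase hphase k⟩
    · have h1 := futureValue_cons (I := I) A (q := (i, v)) hrem
      have h2 := residualValue_le_cons (I := I) (h := h) B (i, v)
      dsimp only at h1
      linarith
    · exact hedge.trans (Finset.card_le_card (adjacentFriends_cons_subset A _))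
  | finish h hphase hno p hp =>
    refine ⟨hp A hA, 0, ?_, by simp, bottleneck_of_not_pairPhase hphase 0⟩
    have h1 := residualValue_nonpos_of_yesAgents_empty B hno
    have h2 := futureValue_nonneg (I := I) (h := h) A
    push_cast
    linarith

/-! ### Welfare -/

theorem residualValue_nil (B : N ≃ V) : residualValue I B [] = ∑ i, I.u i (B i) := by
  classical
  simp [residualValue, Finset.filter_true_of_mem, remainingAgents, availablePlots]

theorem futureValue_nil (A : N ≃ V) : futureValue I A [] = ∑ i, I.u i (A i) := by
  classical
  simp [futureValue, remainingAgents]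

theorem socialWelfare_eq {c : ℚ} (hc : ∀ i j, I.friend.Adj i j → I.φ i j = c) (A : N ≃ V) :
    I.socialWelfare A = ∑ i, I.u i (A i) + c * (adjacentFriends I A []).card := by
  classical
  simp only [PlotInstance.socialWelfare, PlotInstance.utility, Finset.sum_add_distrib]
  congr 1
  rw [Finset.card_eq_sum_ones, Nat.cast_sum, Finset.mul_sum, adjacentFriends, Finset.sum_filter,
    Fintype.sum_prod_type]
  refine Finset.sum_congr rfl fun i _ => ?_
  rw [Finset.sum_filter]
  refine Finset.sum_congr rfl fun j _ => ?_
  by_cases hij : I.friend.Adj i j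
  · simp [hij, hc i j hij]
  · simp [hij]

theorem one_lt_of_one_lt_phiMin (hphi : 1 < I.phiMin) (i j : N) (hij : I.friend.Adj i j) :
    1 < I.φ i j := by
  classical
  have hle : I.phiMin ≤ ((I.φ i j : ℚ) : WithTop ℚ) :=
    Finset.inf_le (f := fun p : N × N => ((I.φ p.1 p.2 : ℚ) : WithTop ℚ)) (b := (i, j))
      (by simpa using hij)
  exact_mod_cast hphi.trans_le hle

/-- Every possible final allocation has at least a quarter of the welfare of any allocation. -/
theorem IsOutcome.socialWelfare_le (hfriend : I.AtMostOneFriend) (hbinary : I.Binary)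
    (huniform : I.FriendshipUniform) (hphi : 1 < I.phiMin) (hreport : I.TruthfulReport report)
    {p : PMF (N ≃ V)} (hp : IsOutcome I report [] p) {A : N ≃ V} (hA : A ∈ p.support)
    (B : N ≃ V) : I.socialWelfare B ≤ 4 * I.socialWelfare A := by
  obtain ⟨c, hc, hcφ⟩ := huniform
  have hφ := one_lt_of_one_lt_phiMin hphi
  obtain ⟨-, k, hval, hedge, hbot⟩ := hp.exists_calls hbinary hφ hreport B hA
  have hB := hbot.card_adjacentFriends_le hfriend hreport B
  have hA0 := futureValue_nonneg (I := I) (h := []) A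
  rw [futureValue_nil] at hA0 hval
  rw [residualValue_nil] at hval
  rw [socialWelfare_eq hcφ, socialWelfare_eq hcφ]
  have hBq : ((adjacentFriends I B []).card : ℚ) ≤ 4 * k := by exact_mod_cast hB
  have hAq : (2 * k : ℚ) ≤ (adjacentFriends I A []).card := by exact_mod_cast hedge
  -- Without friends `c` may be less than one, but then there are no calls.
  have hck : (k : ℚ) ≤ c * k := by
    rcases Nat.eq_zero_or_pos k with rfl | hk
    · simp
    · obtain ⟨q, hq⟩ := Finset.card_pos.mp (show 0 < (adjacentFriends I A []).card by omega)
      have hadj := (mem_adjacentFriends.mp hq).1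
      have h1 : 1 < c := hcφ _ _ hadj ▸ hφ _ _ hadj
      exact le_mul_of_one_le_left (Nat.cast_nonneg k) h1.le
  have h1 := mul_le_mul_of_nonneg_left hBq hc.le
  have h2 := mul_le_mul_of_nonneg_left hAq hc.le
  linarith

end FFCT

theorem theorem5p1 {N V : Type*} [Fintype N] [Fintype V] (I : PlotInstance N V)
    (hfriend : I.AtMostOneFriend) (hbinary : I.Binary) (huniform : I.FriendshipUniform)
    (hphi : 1 < I.phiMin)
    (report : N → Option N) (hreport : I.TruthfulReport report)
    (p : PMF (N ≃ V)) (hp : FFCT.IsOutcome I report [] p) :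
    (1 / 4 : ℝ) * (I.opt : ℝ) ≤ I.expectedWelfare p := by
  classical
  have hopt : ∀ A ∈ p.support, I.opt ≤ 4 * I.socialWelfare A := fun A hA =>
    Finset.sup'_le _ _ fun B _ =>
      hp.socialWelfare_le hfriend hbinary huniform hphi hreport hA B
  have key : (1 / 4 : ℝ) * (I.opt : ℝ) ≤ ∑ A : N ≃ V, (p A).toReal * (I.socialWelfare A : ℝ) := by
    refine FFCT.le_sum_toReal_mul p _ _ fun A hA => ?_
    have : (I.opt : ℝ) ≤ 4 * (I.socialWelfare A : ℝ) := by exact_mod_cast hopt A hA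
    linarith
  convert key using 1
  unfold PlotInstance.expectedWelfare
  congr!
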